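/- For a set $\mathcal{C}\subseteq\mathbb{R}^d$ let $\omega(\mathcal{C})=\mathbb{E}\big[\sup_{v\in\mathcal{C},\,\|v\|_2\le 1}(v^\top g)^2\big]$ with $g\sim\mathcal{N}(0,I_d)$ (and $\sup\emptyset=0$); for a finite family of reals let $\mathrm{sumtop}_k$ denote the sum of its $k$ largest members (of all members if there are fewer than $k$). For $a\in\mathbb{R}^b$ and an integer $s\ge 0$ say that $a$ is piecewise constant with at most $s$ breaks if $a_i\ne a_{i+1}$ for at most $s$ indices $1\le i<b$, and piecewise linear with at most $s$ breaks if the indices $1,\dots,b$ can be split into at most $s+1$ consecutive segments on each of which $a_i$ is an affine function of $i$. Let $b_1,\dots,b_p$ be the block sizes, write $v\in\mathbb{R}^{b_1+\dots+b_p}$ as $v=(v^1,\dots,v^p)$ with $v^j\in\mathbb{R}^{b_j}$, and call $v$ $s_G$-group sparse if at most $s_G$ of its blocks are nonzero. There is an absolute constant $c>0$ such that the following three statements hold. 1. Let $\mathcal{C}$ be the set of $s_G$-group sparse $v$ such that, for every $j\le p$, the entries of $v^j$ sum to $0$ and $v^j$ is piecewise constant (respectively piecewise linear; the kind may be chosen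 for each $j$) with at most $s_{L,j}$ breaks. If $p=1$ and $v^1$ is of the piecewise-linear kind, assume $s_{L,1}\ge 1$. Then $$\omega(\mathcal{C})\le c\cdot\mathrm{sumtop}_{s_G}\big(\{s_{L,j}\log b_j+\log p\}_{1\le j\le p}\big).$$ 2. Let $\mathcal{S}_j\subseteq\mathbb{R}^{b_j}$ $(1\le j\le p)$ be arbitrary cones (sets closed under multiplication by positive scalars) and let $\mathcal{C}$ be the set of $s_G$-group sparse $v$ with $v^j\in\mathcal{S}_j$ for every $j$. Then $$\omega(\mathcal{C})\le\Big(\sqrt{\mathrm{sumtop}_{s_G}\{\omega(\mathcal{S}_j)\}_{1\le j\le p}}+c\sqrt{s_G\log p}\Big)^2.$$ 3. Let $b\ge 2$ and $s_L\ge 1$, and let $\mathcal{S}\subseteq\mathbb{R}^b$ be the set of vectors that are piecewise constant with at most $s_L$ breaks, or the set of vectors that are piecewise linear with at most $s_L$ breaks. Then $$\omega(\mathcal{S})\le c\,s_L\log b.$$ -/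

import Mathlib

open MeasureTheory ProbabilityTheory

/-- The Gaussian complexity `ω(C) = 𝔼 [sup_{v ∈ C, ‖v‖ ≤ 1} ⟨v, g⟩²]`, with `g` standard normal.
The supremum is bounded by `‖g‖²` and the integrand is integrable, see
`bddAbove_gaussianComplexity` and `integrable_gaussianComplexity`. -/
noncomputable def gaussianComplexity {ι : Type*} [Fintype ι] (C : Set (EuclideanSpace ℝ ι)) : ℝ :=
  ∫ g, sSup ((fun v => (inner ℝ v g) ^ 2) '' {v | v ∈ C ∧ ‖v‖ ≤ 1})
    ∂(stdGaussian (EuclideanSpace ℝ ι))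

theorem gaussianComplexity_value_le {ι : Type*} [Fintype ι] {v : EuclideanSpace ℝ ι}
    (hv : ‖v‖ ≤ 1) (g : EuclideanSpace ℝ ι) : (inner ℝ v g) ^ 2 ≤ ‖g‖ ^ 2 := by
  have h1 : |inner ℝ v g| ≤ ‖g‖ :=
    (abs_real_inner_le_norm v g).trans (mul_le_of_le_one_left (norm_nonneg g) hv)
  rw [← sq_abs]
  gcongr

theorem bddAbove_gaussianComplexity {ι : Type*} [Fintype ι] (C : Set (EuclideanSpace ℝ ι))
    (g : EuclideanSpace ℝ ι) :
    BddAbove ((fun v => (inner ℝ v g) ^ 2) '' {v | v ∈ C ∧ ‖v‖ ≤ 1}) := by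
  refine ⟨‖g‖ ^ 2, ?_⟩
  rintro _ ⟨v, hv, rfl⟩
  exact gaussianComplexity_value_le hv.2 g

theorem integrable_gaussianComplexity {ι : Type*} [Fintype ι] (C : Set (EuclideanSpace ℝ ι)) :
    Integrable (fun g => sSup ((fun v => (inner ℝ v g) ^ 2) '' {v | v ∈ C ∧ ‖v‖ ≤ 1}))
      (stdGaussian (EuclideanSpace ℝ ι)) := by
  have hm : Measurable (fun g : EuclideanSpace ℝ ι =>
      sSup ((fun v => (inner ℝ v g) ^ 2) '' {v | v ∈ C ∧ ‖v‖ ≤ 1})) := by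
    simp_rw [sSup_image']
    apply LowerSemicontinuous.measurable
    apply lowerSemicontinuous_ciSup
    · intro g
      refine ⟨‖g‖ ^ 2, ?_⟩
      rintro _ ⟨v, rfl⟩
      exact gaussianComplexity_value_le v.2.2 g
    · intro v
      apply Continuous.lowerSemicontinuous
      fun_prop
  have hi : Integrable (fun g : EuclideanSpace ℝ ι => ‖g‖ ^ 2)
      (stdGaussian (EuclideanSpace ℝ ι)) :=
    (IsGaussian.memLp_two_id (μ := stdGaussian (EuclideanSpace ℝ ι))).integrable_norm_pow
      (by norm_num)
  refine hi.mono' hm.aestronglyMeasurable (Filter.Eventually.of_forall fun g => ?_)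
  have h0 : 0 ≤ sSup ((fun v => (inner ℝ v g) ^ 2) '' {v | v ∈ C ∧ ‖v‖ ≤ 1}) := by
    apply Real.sSup_nonneg
    rintro _ ⟨v, _, rfl⟩
    positivity
  rw [Real.norm_of_nonneg h0]
  apply Real.sSup_le
  · rintro _ ⟨v, hv, rfl⟩
    exact gaussianComplexity_value_le hv.2 g
  · positivity

/-- `sumtop k a`: the sum of the `k` largest members of the finite family `a` (of all members when
there are fewer than `k`), that is, the largest sum over `min k n` distinct indices. -/
noncomputable def sumtop {ι : Type*} [Fintype ι] (k : ℕ) (a : ι → ℝ) : ℝ :=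
  (Finset.powersetCard (min k (Fintype.card ι)) (Finset.univ : Finset ι)).sup'
    (Finset.powersetCard_nonempty.2 (min_le_right _ _)) (fun T => ∑ j ∈ T, a j)

/-- The ambient space `ℝ^{b_1 + ⋯ + b_p}` of vectors with blocks of sizes `b_1, …, b_p`. -/
abbrev BinSpace {p : ℕ} (b : Fin p → ℕ) : Type := EuclideanSpace ℝ (Σ j : Fin p, Fin (b j))

/-- The `j`-th block `v^j ∈ ℝ^{b_j}` of `v`. -/
def block {p : ℕ} {b : Fin p → ℕ} (v : BinSpace b) (j : Fin p) : EuclideanSpace ℝ (Fin (b j)) :=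
  WithLp.toLp 2 (fun k => v ⟨j, k⟩)

open Classical in
/-- Group sparsity `‖v‖_G`: the number of nonzero blocks. -/
noncomputable def groupSparsity {p : ℕ} {b : Fin p → ℕ} (v : BinSpace b) : ℕ :=
  (Finset.univ.filter fun j => block v j ≠ 0).card

open Classical in
/-- `‖a‖_PC`: the number of `i` with `a_i ≠ a_{i+1}`. -/
noncomputable def pcSmoothness {d : ℕ} (a : EuclideanSpace ℝ (Fin d)) : ℕ :=
  (Finset.univ.filter fun i : Fin d => ∃ h : (i : ℕ) + 1 < d, a i ≠ a ⟨(i : ℕ) + 1, h⟩).card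

/-- `a` is piecewise linear with at most `s` breakpoints: the indices are split into `s + 1`
consecutive (possibly empty) segments, the `t`-th being `σ ⁻¹' {t}`, and on the `t`-th segment
`a_i = α_t i + β_t`. -/
def IsPiecewiseLinear {d : ℕ} (s : ℕ) (a : EuclideanSpace ℝ (Fin d)) : Prop :=
  ∃ (σ : Fin d → Fin (s + 1)) (α β : Fin (s + 1) → ℝ),
    Monotone σ ∧ ∀ i : Fin d, a i = α (σ i) * (i : ℝ) + β (σ i)

/-- The two kinds of local smoothness. -/
inductive LocalModel where
  | piecewiseConstant
  | piecewiseLinear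

/-- The local constraint `‖a‖_L ≤ s`. -/
def LocalModel.Holds : LocalModel → {d : ℕ} → ℕ → EuclideanSpace ℝ (Fin d) → Prop
  | .piecewiseConstant, _, s, a => pcSmoothness a ≤ s
  | .piecewiseLinear, _, s, a => IsPiecewiseLinear s a

/-- The `sG`-group-sparse vectors whose `j`-th block lies in `S j` for every `j`. -/
def groupSparseSet {p : ℕ} {b : Fin p → ℕ} (sG : ℕ)
    (S : (j : Fin p) → Set (EuclideanSpace ℝ (Fin (b j)))) : Set (BinSpace b) :=
  {v | groupSparsity v ≤ sG ∧ ∀ j, block v j ∈ S j}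

/-- The constraint set: at most `sG` nonzero blocks, the `j`-th block having local smoothness at most
`sL j` (of the kind `m j`) and entries that sum to zero. -/
def constraintSet {p : ℕ} (b : Fin p → ℕ) (m : Fin p → LocalModel) (sG : ℕ) (sL : Fin p → ℕ) :
    Set (BinSpace b) :=
  {v | groupSparsity v ≤ sG ∧ ∀ j, (m j).Holds (sL j) (block v j) ∧ ∑ k, block v j k = 0}

/-!
Everything rests on Gaussian concentration: a `1`-Lipschitz function `F` of a standard Gaussian
vector satisfies `𝔼 exp (c (F - 𝔼 F)) ≤ exp (π² c² / 8)` (`integral_exp_lipschitz_sub_mean_le`).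
This is the rotation argument of Maurey and Pisier, in a discrete form. For independent `X`, `Y`
the pair is invariant under rotations, so Jensen's inequality over `n` equal steps of the
rotation from `X` to `Y` bounds `𝔼 exp (c (F Y - F X))` by the exponential moment of a single
step scaled by `n`. As `n → ∞` the scaled step tends to `(π / 2) F'(X) Y` almost surely, by
Rademacher's theorem, with the domination provided by Fernique's theorem; the limit is
conditionally Gaussian given `X`, with standard deviation at most `π / 2`.

Consequently the squared upper deviations of `N` such functions have a common majorant with
integral `O(1 + log N)` (`exists_integrable_deviation_majorant`). It is applied to the support
functions `gaussianSup C g = sup_{v ∈ C, ‖v‖ ≤ 1} |⟨v, g⟩|`, which are `1`-Lipschitz with second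
moment `ω(C)`, hence with mean at most `√ω(C)`.

* For a union of `N` sets of complexity at most `d` this gives `2 d + O(1 + log N)`
  (`gaussianComplexity_le_of_subset_iUnion`). Piecewise-linear vectors with `s` breaks in `ℝ^b`
  are covered by `(b + 1) ^ s` subspaces of dimension at most `2 (s + 1)`, each of
  complexity at most its dimension; piecewise-constant vectors are among them.
* For group-sparse vectors with blocks in cones, Cauchy–Schwarz bounds `⟨v, g⟩²` by the sum of
  the squared support functions over the at most `sG` active blocks. Separating means and
  deviations gives `(√sumtop + O(√(sG log p)))²` (`gaussianComplexity_groupSparseSet_le`). The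
  constant in front of `√sumtop` is exactly `1`, so the case where all blocks may be active, and
  with it `p = 1`, where `log p = 0`, is treated without any deviation term.
* The constraint set combines the two. A centered block without breaks vanishes in the
  piecewise-constant case. In the piecewise-linear case its complexity is bounded by a constant,
  which is at most a multiple of `log p` as soon as `p ≥ 2`.
-/

/-! ### Gaussian concentration for Lipschitz functions -/

section GaussianConcentration

open Filter Topology
open scoped Real

theorem pi_gaussianReal_absolutelyContinuous (n : ℕ) :
    Measure.pi (fun _ : Fin n => gaussianReal 0 1) ≪ (volume : Measure (Fin n → ℝ)) := by
  induction n with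
  | zero =>
    rw [volume_pi, Measure.pi_of_empty, Measure.pi_of_empty]
  | succ n ih =>
    have h1 := (measurePreserving_piFinSuccAbove
      (fun _ : Fin (n + 1) => gaussianReal 0 1) 0).symm.map_eq
    have h2 := (volume_preserving_piFinSuccAbove (fun _ : Fin (n + 1) => ℝ) 0).symm.map_eq
    rw [← h1, ← h2]
    exact ((gaussianReal_absolutelyContinuous 0 one_ne_zero).prod ih).map
      (MeasurableEquiv.measurable _)

variable {E : Type*} [NormedAddCommGroup E] [InnerProductSpace ℝ E] [FiniteDimensional ℝ E]
  [MeasurableSpace E] [BorelSpace E]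

/-- Needed to apply Rademacher's theorem, which speaks of Lebesgue-almost every point, to a
Gaussian vector. -/
theorem stdGaussian_absolutelyContinuous : stdGaussian E ≪ (volume : Measure E) := by
  have h2 := (stdOrthonormalBasis ℝ E).measurePreserving_repr_symm.comp
    (PiLp.volume_preserving_toLp (Fin (Module.finrank ℝ E)))
  have h3 : (fun x : Fin (Module.finrank ℝ E) → ℝ => ∑ i, x i • stdOrthonormalBasis ℝ E i) =
      (stdOrthonormalBasis ℝ E).repr.symm ∘ WithLp.toLp 2 := by
    ext x
    simp [← OrthonormalBasis.sum_repr_symm]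
  rw [stdGaussian, h3, ← h2.map_eq]
  exact (pi_gaussianReal_absolutelyContinuous _).map h2.measurable

theorem integrable_exp_mul_norm_stdGaussian (c : ℝ) :
    Integrable (fun x => Real.exp (c * ‖x‖)) (stdGaussian E) := by
  obtain ⟨C, hC, hi⟩ := IsGaussian.exists_integrable_exp_sq (stdGaussian E)
  refine (hi.const_mul (Real.exp (c ^ 2 / (4 * C)))).mono' (by fun_prop)
    (Eventually.of_forall fun x => ?_)
  rw [Real.norm_of_nonneg (Real.exp_pos _).le, ← Real.exp_add, Real.exp_le_exp]
  have : c ^ 2 / (4 * C) + C * ‖x‖ ^ 2 - c * ‖x‖ = C * (‖x‖ - c / (2 * C)) ^ 2 := by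
    field_simp
    ring
  have h2 : 0 ≤ C * (‖x‖ - c / (2 * C)) ^ 2 := by positivity
  linarith

theorem integral_exp_strongDual_stdGaussian (L : StrongDual ℝ E) :
    ∫ x, Real.exp (L x) ∂(stdGaussian E) = Real.exp (‖L‖ ^ 2 / 2) := by
  have h := mgf_gaussianReal (IsGaussian.map_eq_gaussianReal (μ := stdGaussian E) L) 1
  simp only [mgf, one_mul] at h
  rw [h, integral_strongDual_stdGaussian, variance_dual_stdGaussian,
    Real.coe_toNNReal _ (by positivity)]
  ring_nf

theorem integrable_exp_norm_add_norm (C : ℝ) :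
    Integrable (fun p : E × E => Real.exp (C * (‖p.1‖ + ‖p.2‖)))
      ((stdGaussian E).prod (stdGaussian E)) := by
  simp_rw [mul_add, Real.exp_add]
  exact (integrable_exp_mul_norm_stdGaussian C).mul_prod (integrable_exp_mul_norm_stdGaussian C)

theorem integrable_exp_of_abs_le {G : E × E → ℝ} {C : ℝ}
    (hG : AEStronglyMeasurable G ((stdGaussian E).prod (stdGaussian E)))
    (h : ∀ p, |G p| ≤ C * (‖p.1‖ + ‖p.2‖)) :
    Integrable (fun p => Real.exp (G p)) ((stdGaussian E).prod (stdGaussian E)) := by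
  refine (integrable_exp_norm_add_norm C).mono'
    (Real.continuous_exp.comp_aestronglyMeasurable hG) (Eventually.of_forall fun p => ?_)
  rw [Real.norm_of_nonneg (Real.exp_pos _).le, Real.exp_le_exp]
  exact (le_abs_self _).trans (h p)

variable {F : E → ℝ}

theorem integrable_exp_lipschitz_sub (hF : LipschitzWith 1 F) (c : ℝ) (A B : E × E →L[ℝ] E) :
    Integrable (fun p => Real.exp (c * (F (A p) - F (B p))))
      ((stdGaussian E).prod (stdGaussian E)) := by
  have hc := hF.continuous
  refine integrable_exp_of_abs_le (C := |c| * ‖A - B‖)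
    (Continuous.aestronglyMeasurable (by fun_prop)) fun p => ?_
  have h1 : |F (A p) - F (B p)| ≤ ‖A p - B p‖ := by
    simpa using hF.norm_sub_le (A p) (B p)
  have h2 : ‖A p - B p‖ ≤ ‖A - B‖ * ‖p‖ := (A - B).le_opNorm p
  have h3 : ‖p‖ ≤ ‖p.1‖ + ‖p.2‖ := by
    rw [Prod.norm_def]
    exact max_le (by simp) (by simp)
  rw [abs_mul, mul_assoc]
  gcongr
  exact h1.trans (h2.trans (by gcongr))

/-- The telescoping step of the Maurey–Pisier argument: along the rotation from `X` to `Y` in `n`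
equal angles, each increment of `F` has the law of the first one, and convexity of the exponential
bounds the whole by their average. -/
theorem integral_exp_sub_le_rotation (hF : LipschitzWith 1 F) (c : ℝ) {n : ℕ} (hn : n ≠ 0) :
    ∫ p, Real.exp (c * (F p.2 - F p.1)) ∂((stdGaussian E).prod (stdGaussian E)) ≤
      ∫ p, Real.exp (c * n *
        (F (ContinuousLinearMap.rotation (π / 2 / n) p).1 - F p.1))
        ∂((stdGaussian E).prod (stdGaussian E)) := by
  set h : ℝ := π / 2 / n with hh
  have hn' : (n : ℝ) ≠ 0 := by exact_mod_cast hn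
  let R : ℕ → E × E →L[ℝ] E × E := fun k => ContinuousLinearMap.rotation (k * h)
  let Q : E × E →L[ℝ] E × E := ContinuousLinearMap.rotation h
  have hR0 : ∀ p, (R 0 p).1 = p.1 := fun p => by
    simp [R, ContinuousLinearMap.rotation_apply]
  have hRn : ∀ p, (R n p).1 = p.2 := fun p => by
    have : (n : ℝ) * h = π / 2 := by rw [hh]; field_simp
    simp [R, ContinuousLinearMap.rotation_apply, this]
  have hRs : ∀ k p, (R (k + 1) p).1 = (Q (R k p)).1 := fun k p => by
    have : ((k + 1 : ℕ) : ℝ) * h = k * h + h := by push_cast; ring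
    simp only [R, Q, ContinuousLinearMap.rotation_apply, this, Real.cos_add, Real.sin_add]
    module
  have hmap : ∀ k, ((stdGaussian E).prod (stdGaussian E)).map (R k) =
      (stdGaussian E).prod (stdGaussian E) := fun k =>
    IsGaussian.map_rotation_eq_self (by simp) _
  have hc := hF.continuous
  have hint : ∀ k, ∫ p, Real.exp (c * n * (F (R (k + 1) p).1 - F (R k p).1))
        ∂((stdGaussian E).prod (stdGaussian E)) =
      ∫ p, Real.exp (c * n * (F (Q p).1 - F p.1)) ∂((stdGaussian E).prod (stdGaussian E)) := by
    intro k
    conv_rhs => rw [← hmap k]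
    rw [integral_map (by fun_prop) (Continuous.aestronglyMeasurable (by fun_prop))]
    simp_rw [hRs]
  have hI : ∀ k, Integrable (fun p => Real.exp (c * n * (F (R (k + 1) p).1 - F (R k p).1)))
      ((stdGaussian E).prod (stdGaussian E)) := fun k =>
    integrable_exp_lipschitz_sub hF (c * n) ((ContinuousLinearMap.fst ℝ E E).comp (R (k + 1)))
      ((ContinuousLinearMap.fst ℝ E E).comp (R k))
  calc ∫ p, Real.exp (c * (F p.2 - F p.1)) ∂((stdGaussian E).prod (stdGaussian E))
      ≤ ∫ p, ∑ k ∈ Finset.range n, (1 / n : ℝ) *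
          Real.exp (c * n * (F (R (k + 1) p).1 - F (R k p).1))
          ∂((stdGaussian E).prod (stdGaussian E)) := by
        refine integral_mono (integrable_exp_lipschitz_sub hF c (ContinuousLinearMap.snd ℝ E E)
          (ContinuousLinearMap.fst ℝ E E))
          (integrable_finsetSum _ fun k _ => (hI k).const_mul _) fun p => ?_
        have hs : c * (F p.2 - F p.1) = ∑ k ∈ Finset.range n, (1 / n : ℝ) •
            (c * n * (F (R (k + 1) p).1 - F (R k p).1)) := by
          simp_rw [smul_eq_mul]
          rw [← Finset.mul_sum, ← Finset.mul_sum,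
            Finset.sum_range_sub (fun k => F (R k p).1), hR0, hRn]
          field_simp
        simp only [hs]
        refine (convexOn_exp.map_sum_le (fun _ _ => by positivity) ?_ (by simp)).trans
          (by simp)
        simp [hn']
    _ = _ := by
        rw [integral_finsetSum _ fun k _ => (hI k).const_mul _]
        simp_rw [integral_const_mul, hint]
        simp only [Finset.sum_const, Finset.card_range, nsmul_eq_mul]
        field_simp
        rfl

omit [FiniteDimensional ℝ E] [MeasurableSpace E] [BorelSpace E] in
/-- The first increment along the rotation from `x` to `y` in `n` equal angles, scaled by `n`,
converges to `π / 2` times the derivative at `x` in the direction `y`. -/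
theorem tendsto_rotation_increment {x : E} (hx : DifferentiableAt ℝ F x) (y : E) :
    Tendsto (fun n : ℕ => (n : ℝ) *
        (F (ContinuousLinearMap.rotation (π / 2 / n) (x, y)).1 - F x))
      atTop (𝓝 (π / 2 * fderiv ℝ F x y)) := by
  have hγ : HasDerivAt (fun t : ℝ => Real.cos t • x + Real.sin t • y) y 0 := by
    have := ((Real.hasDerivAt_cos 0).smul_const x).add ((Real.hasDerivAt_sin 0).smul_const y)
    simpa [Pi.add_def] using this
  have hd : HasDerivAt (fun t : ℝ => F (Real.cos t • x + Real.sin t • y)) (fderiv ℝ F x y) 0 := by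
    refine HasFDerivAt.comp_hasDerivAt (0 : ℝ) (l := F) ?_ hγ
    simpa using hx.hasFDerivAt
  have ht := hasDerivAt_iff_tendsto_slope_zero.1 hd
  have hs : Tendsto (fun n : ℕ => π / 2 / (n : ℝ)) atTop (𝓝[≠] 0) := by
    refine tendsto_nhdsWithin_iff.2 ⟨tendsto_const_div_atTop_nhds_zero_nat _, ?_⟩
    filter_upwards [eventually_ge_atTop 1] with n hn
    have : (0 : ℝ) < n := by exact_mod_cast hn
    have := Real.pi_pos
    simp only [Set.mem_compl_iff, Set.mem_singleton_iff]
    positivity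
  refine ((ht.comp hs).const_mul (π / 2)).congr fun n => ?_
  have := Real.pi_pos
  simp only [Function.comp_apply, zero_add, Real.cos_zero, one_smul, Real.sin_zero, zero_smul,
    add_zero, smul_eq_mul, ContinuousLinearMap.rotation_apply]
  field_simp

omit [FiniteDimensional ℝ E] [MeasurableSpace E] [BorelSpace E] in
theorem abs_rotation_increment_le (hF : LipschitzWith 1 F) {n : ℕ} (hn : n ≠ 0) (p : E × E) :
    |(n : ℝ) * (F (ContinuousLinearMap.rotation (π / 2 / n) p).1 - F p.1)| ≤
      π / 2 * (‖p.1‖ + ‖p.2‖) := by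
  have hn1 : (1 : ℝ) ≤ n := by exact_mod_cast Nat.one_le_iff_ne_zero.2 hn
  have hn0 : (0 : ℝ) < n := by linarith
  set h : ℝ := π / 2 / n with hh
  have h0 : 0 ≤ h := by positivity
  have h2 : h ≤ 2 := by
    rw [hh, div_le_iff₀ hn0]
    nlinarith [Real.pi_le_four]
  have hcos : |Real.cos h - 1| ≤ h := by
    rw [abs_sub_comm, abs_of_nonneg (by linarith [Real.cos_le_one h])]
    nlinarith [Real.one_sub_sq_div_two_le_cos (x := h)]
  have hsin : |Real.sin h| ≤ h := by
    simpa [abs_of_nonneg h0] using Real.abs_sin_le_abs (x := h)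
  have h1 : |F (ContinuousLinearMap.rotation h p).1 - F p.1| ≤ h * (‖p.1‖ + ‖p.2‖) := by
    refine (by simpa using hF.norm_sub_le (ContinuousLinearMap.rotation h p).1 p.1 :
      |F (ContinuousLinearMap.rotation h p).1 - F p.1| ≤ _).trans ?_
    have : (ContinuousLinearMap.rotation h p).1 - p.1 =
        (Real.cos h - 1) • p.1 + Real.sin h • p.2 := by
      rw [ContinuousLinearMap.rotation_apply]
      module
    rw [this]
    refine (norm_add_le _ _).trans ?_
    rw [norm_smul, norm_smul, Real.norm_eq_abs, Real.norm_eq_abs, mul_add]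
    gcongr
  rw [abs_mul, abs_of_pos hn0]
  calc (n : ℝ) * _ ≤ n * (h * (‖p.1‖ + ‖p.2‖)) := by gcongr
    _ = _ := by rw [hh]; field_simp

/-- The Maurey–Pisier bound for two independent standard Gaussian vectors. -/
theorem integral_exp_lipschitz_sub_le (hF : LipschitzWith 1 F) (c : ℝ) :
    ∫ p, Real.exp (c * (F p.2 - F p.1)) ∂((stdGaussian E).prod (stdGaussian E)) ≤
      Real.exp (π ^ 2 / 8 * c ^ 2) := by
  have hFc := hF.continuous
  set μ := stdGaussian E with hμ
  -- by Rademacher's theorem the increments converge almost everywhere to directional derivatives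
  have hae : ∀ᵐ p ∂(μ.prod μ), Tendsto (fun n : ℕ => Real.exp (c * n *
      (F (ContinuousLinearMap.rotation (π / 2 / n) p).1 - F p.1))) atTop
      (𝓝 (Real.exp (c * (π / 2) * fderiv ℝ F p.1 p.2))) := by
    have h1 : ∀ᵐ x ∂μ, DifferentiableAt ℝ F x :=
      stdGaussian_absolutelyContinuous.ae_le hF.ae_differentiableAt
    filter_upwards [Measure.quasiMeasurePreserving_fst.ae h1] with p hp
    refine (Real.continuous_exp.tendsto _).comp ?_
    simpa only [mul_assoc] using (tendsto_rotation_increment hp p.2).const_mul c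
  have hmeas : ∀ n : ℕ, AEStronglyMeasurable (fun p : E × E => Real.exp (c * n *
      (F (ContinuousLinearMap.rotation (π / 2 / n) p).1 - F p.1))) (μ.prod μ) := fun n =>
    Continuous.aestronglyMeasurable (by fun_prop)
  have hlim : Tendsto (fun n : ℕ => ∫ p, Real.exp (c * n *
      (F (ContinuousLinearMap.rotation (π / 2 / n) p).1 - F p.1)) ∂(μ.prod μ)) atTop
      (𝓝 (∫ p, Real.exp (c * (π / 2) * fderiv ℝ F p.1 p.2) ∂(μ.prod μ))) := by
    refine tendsto_integral_filter_of_dominated_convergence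
      (fun p => Real.exp (|c| * (π / 2) * (‖p.1‖ + ‖p.2‖)))
      (Eventually.of_forall hmeas) ?_ (integrable_exp_norm_add_norm _) hae
    filter_upwards [eventually_ne_atTop 0] with n hn
    refine Eventually.of_forall fun p => ?_
    rw [Real.norm_of_nonneg (Real.exp_pos _).le, Real.exp_le_exp, mul_assoc, mul_assoc]
    refine (le_abs_self _).trans ?_
    rw [abs_mul]
    gcongr
    exact abs_rotation_increment_le hF hn p
  have hnorm : ∀ x, ‖fderiv ℝ F x‖ ≤ 1 := fun x => by
    simpa using norm_fderiv_le_of_lipschitz ℝ hF (x₀ := x)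
  have hint : Integrable (fun p : E × E => Real.exp (c * (π / 2) * fderiv ℝ F p.1 p.2))
      (μ.prod μ) := by
    refine (integrable_exp_norm_add_norm (|c| * (π / 2))).mono'
      (aestronglyMeasurable_of_tendsto_ae _ hmeas hae) (Eventually.of_forall fun p => ?_)
    rw [Real.norm_of_nonneg (Real.exp_pos _).le, Real.exp_le_exp]
    refine (le_abs_self _).trans ?_
    rw [abs_mul, abs_mul, abs_of_pos (by positivity : 0 < π / 2)]
    gcongr
    calc |fderiv ℝ F p.1 p.2| ≤ ‖fderiv ℝ F p.1‖ * ‖p.2‖ := (fderiv ℝ F p.1).le_opNorm _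
      _ ≤ 1 * ‖p.2‖ := by gcongr; exact hnorm _
      _ ≤ _ := by simp
  calc _ ≤ ∫ p, Real.exp (c * (π / 2) * fderiv ℝ F p.1 p.2) ∂(μ.prod μ) := by
        refine ge_of_tendsto hlim ?_
        filter_upwards [eventually_ne_atTop 0] with n hn
        exact integral_exp_sub_le_rotation hF c hn
    _ = ∫ x, ∫ y, Real.exp (c * (π / 2) * fderiv ℝ F x y) ∂μ ∂μ := integral_prod _ hint
    _ ≤ ∫ _, Real.exp (π ^ 2 / 8 * c ^ 2) ∂μ := by
        refine integral_mono hint.integral_prod_left (integrable_const _) fun x => ?_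
        have := integral_exp_strongDual_stdGaussian ((c * (π / 2)) • fderiv ℝ F x)
        simp only [FunLike.coe_smul, Pi.smul_apply, smul_eq_mul] at this
        rw [← hμ] at this
        simp only [this]
        rw [Real.exp_le_exp, norm_smul, mul_pow, Real.norm_eq_abs, sq_abs]
        have h1 : ‖fderiv ℝ F x‖ ^ 2 ≤ 1 := pow_le_one₀ (norm_nonneg _) (hnorm x)
        calc (c * (π / 2)) ^ 2 * ‖fderiv ℝ F x‖ ^ 2 / 2 ≤ (c * (π / 2)) ^ 2 * 1 / 2 := by gcongr
          _ = _ := by ring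
    _ = _ := by simp

theorem integrable_exp_mul_lipschitz (hF : LipschitzWith 1 F) (c : ℝ) :
    Integrable (fun x => Real.exp (c * F x)) (stdGaussian E) := by
  have hFc := hF.continuous
  refine ((integrable_exp_mul_norm_stdGaussian |c|).const_mul (Real.exp (|c| * |F 0|))).mono'
    (Continuous.aestronglyMeasurable (by fun_prop)) (Eventually.of_forall fun x => ?_)
  rw [Real.norm_of_nonneg (Real.exp_pos _).le, ← Real.exp_add, Real.exp_le_exp, ← mul_add]
  refine (le_abs_self _).trans ?_
  rw [abs_mul]
  gcongr
  have h1 : |F x - F 0| ≤ ‖x‖ := by simpa using hF.norm_sub_le x 0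
  have h2 := abs_add_le (F x - F 0) (F 0)
  simp only [sub_add_cancel] at h2
  linarith

theorem integrable_lipschitz (hF : LipschitzWith 1 F) : Integrable F (stdGaussian E) := by
  have hFc := hF.continuous
  refine (((IsGaussian.integrable_id (μ := stdGaussian E)).norm).add
    (integrable_const |F 0|)).mono' hFc.aestronglyMeasurable (Eventually.of_forall fun x => ?_)
  have h1 : |F x - F 0| ≤ ‖x‖ := by simpa using hF.norm_sub_le x 0
  have h2 := abs_add_le (F x - F 0) (F 0)
  simp only [sub_add_cancel] at h2
  simp only [Real.norm_eq_abs, id, Pi.add_apply]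
  linarith

/-- **Gaussian concentration**: a `1`-Lipschitz function of a standard Gaussian vector is
sub-Gaussian around its mean. -/
theorem integral_exp_lipschitz_sub_mean_le (hF : LipschitzWith 1 F) (c : ℝ) :
    ∫ x, Real.exp (c * (F x - ∫ y, F y ∂(stdGaussian E))) ∂(stdGaussian E) ≤
      Real.exp (π ^ 2 / 8 * c ^ 2) := by
  set μ := stdGaussian E with hμ
  set m := ∫ y, F y ∂μ with hm
  have hjensen : Real.exp (-c * m) ≤ ∫ x, Real.exp (-c * F x) ∂μ := by
    have := convexOn_exp.map_integral_le (μ := μ) (f := fun x => -c * F x)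
      Real.continuous_exp.continuousOn isClosed_univ (by simp)
      ((integrable_lipschitz hF).const_mul _) (integrable_exp_mul_lipschitz hF (-c))
    rwa [integral_const_mul] at this
  have hprod : ∫ p, Real.exp (c * (F p.2 - F p.1)) ∂(μ.prod μ) =
      (∫ x, Real.exp (-c * F x) ∂μ) * ∫ x, Real.exp (c * F x) ∂μ := by
    rw [← integral_prod_mul]
    congr with p
    rw [← Real.exp_add]
    ring_nf
  calc ∫ x, Real.exp (c * (F x - m)) ∂μ
      = Real.exp (-c * m) * ∫ x, Real.exp (c * F x) ∂μ := by
        rw [← integral_const_mul]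
        congr with x
        rw [← Real.exp_add]
        ring_nf
    _ ≤ (∫ x, Real.exp (-c * F x) ∂μ) * ∫ x, Real.exp (c * F x) ∂μ := by
        gcongr
    _ = _ := hprod.symm
    _ ≤ _ := integral_exp_lipschitz_sub_le hF c

end GaussianConcentration

/-! ### Simultaneous deviations of finitely many Lipschitz functions -/

section Deviation

variable {E : Type*} [NormedAddCommGroup E] [InnerProductSpace ℝ E] [FiniteDimensional ℝ E]
  [MeasurableSpace E] [BorelSpace E]

/-- Squared deviations up to order `l` are absorbed in a constant, larger ones are controlled by
an exponential moment at the rate `l`. With `l ^ 2 = 1 + log N` the factor `exp (-3 * l ^ 2)` pays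
both for the sub-Gaussian moment at `l` and for a sum over `N` functions. -/
theorem max_zero_sq_le_add_exp {z l : ℝ} (hl : 1 ≤ l) :
    max z 0 ^ 2 ≤ l ^ 2 * (18 + 4 * Real.exp (l * z - 3 * l ^ 2)) := by
  have hl0 : 0 < l := by linarith
  rcases le_total z (3 * l) with hz | hz
  · have h1 : max z 0 ≤ 3 * l := max_le hz (by linarith)
    have h2 : max z 0 ^ 2 ≤ (3 * l) ^ 2 := by gcongr
    have h3 : 0 ≤ l ^ 2 * (4 * Real.exp (l * z - 3 * l ^ 2)) := by positivity
    nlinarith [sq_nonneg l]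
  · rw [max_eq_left (by linarith)]
    obtain ⟨t, rfl⟩ : ∃ t, z = l * (3 + t) := ⟨z / l - 3, by field_simp; ring⟩
    have ht : 0 ≤ t := by nlinarith
    have h1 : t ^ 2 ≤ 2 * Real.exp t := by
      linarith [Real.quadratic_le_exp_of_nonneg ht]
    have h2 : Real.exp t ≤ Real.exp (l * (l * (3 + t)) - 3 * l ^ 2) := by
      rw [Real.exp_le_exp]
      nlinarith [mul_nonneg ht (by nlinarith : 0 ≤ l ^ 2 - 1)]
    rw [mul_pow]
    gcongr
    nlinarith [sq_nonneg (t - 3)]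

/-- The squared upper deviations of finitely many `1`-Lipschitz functions have a common integrable
majorant, with integral logarithmic in the number of functions. -/
theorem exists_integrable_deviation_majorant {κ : Type*} [Fintype κ] {F : κ → E → ℝ}
    (hF : ∀ i, LipschitzWith 1 (F i)) :
    ∃ W : E → ℝ, Integrable W (stdGaussian E) ∧
      ∫ g, W g ∂(stdGaussian E) ≤ 22 * (1 + Real.log (Fintype.card κ)) ∧ (∀ g, 0 ≤ W g) ∧
      ∀ i g, max (F i g - ∫ y, F i y ∂(stdGaussian E)) 0 ^ 2 ≤ W g := by
  set μ := stdGaussian E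
  have hlog : 0 ≤ Real.log (Fintype.card κ) := Real.log_natCast_nonneg _
  set l := Real.sqrt (1 + Real.log (Fintype.card κ)) with hl
  have hl2 : l ^ 2 = 1 + Real.log (Fintype.card κ) := Real.sq_sqrt (by linarith)
  have hl1 : 1 ≤ l := Real.one_le_sqrt.2 (by linarith)
  let e : κ → E → ℝ := fun i g => Real.exp (l * (F i g - ∫ y, F i y ∂μ) - 3 * l ^ 2)
  have he : ∀ i, e i = fun g => Real.exp (-(l * ∫ y, F i y ∂μ) - 3 * l ^ 2) *
      Real.exp (l * F i g) := fun i => by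
    ext g
    rw [← Real.exp_add]
    simp only [e]
    ring_nf
  have hei : ∀ i, Integrable (e i) μ := fun i => by
    rw [he]
    exact (integrable_exp_mul_lipschitz (hF i) l).const_mul _
  have hint : ∀ i, ∫ g, e i g ∂μ ≤ Real.exp (-l ^ 2) := fun i => by
    have h1 := integral_exp_lipschitz_sub_mean_le (hF i) l
    have h2 : ∫ g, e i g ∂μ = Real.exp (-3 * l ^ 2) *
        ∫ g, Real.exp (l * (F i g - ∫ y, F i y ∂μ)) ∂μ := by
      rw [← integral_const_mul]
      congr with g
      rw [← Real.exp_add]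
      simp only [e]
      ring_nf
    rw [h2]
    calc _ ≤ Real.exp (-3 * l ^ 2) * Real.exp (Real.pi ^ 2 / 8 * l ^ 2) := by gcongr
      _ ≤ _ := by
        rw [← Real.exp_add, Real.exp_le_exp]
        have : Real.pi ^ 2 ≤ 16 := by nlinarith [Real.pi_pos, Real.pi_le_four]
        nlinarith [sq_nonneg l]
  have hcard : (Fintype.card κ : ℝ) * Real.exp (-l ^ 2) ≤ 1 := by
    rcases Nat.eq_zero_or_pos (Fintype.card κ) with h0 | h0
    · simp [h0]
    · have hpos : (0 : ℝ) < Fintype.card κ := by exact_mod_cast h0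
      calc (Fintype.card κ : ℝ) * Real.exp (-l ^ 2)
          ≤ Fintype.card κ * Real.exp (-Real.log (Fintype.card κ)) := by
            gcongr
            linarith
        _ = 1 := by
            rw [Real.exp_neg, Real.exp_log hpos]
            field_simp
  refine ⟨fun g => l ^ 2 * (18 + 4 * ∑ i, e i g), ?_, ?_, ?_, ?_⟩
  · exact ((integrable_const _).add
      ((integrable_finsetSum _ fun i _ => hei i).const_mul _)).const_mul _
  · rw [integral_const_mul, integral_add (integrable_const _) ((integrable_finsetSum _ fun i _ =>
      hei i).const_mul _), integral_const_mul, integral_finsetSum _ fun i _ => hei i]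
    have h1 : ∑ i, ∫ g, e i g ∂μ ≤ 1 := by
      refine (Finset.sum_le_sum fun i _ => hint i).trans ?_
      simpa using hcard
    rw [← hl2]
    simp only [integral_const, probReal_univ, one_smul]
    nlinarith [sq_nonneg l]
  · intro g
    have : 0 ≤ ∑ i, e i g := Finset.sum_nonneg fun i _ => (Real.exp_pos _).le
    positivity
  · intro i g
    refine (max_zero_sq_le_add_exp hl1).trans ?_
    refine mul_le_mul_of_nonneg_left ?_ (sq_nonneg l)
    gcongr
    exact Finset.single_le_sum (f := fun i => e i g) (fun i _ => (Real.exp_pos _).le)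
      (Finset.mem_univ i)

end Deviation

/-! ### The support function and general bounds for the Gaussian complexity -/

section GaussianSup

variable {ι : Type*} [Fintype ι] {C D : Set (EuclideanSpace ℝ ι)}

/-- The support function `g ↦ sup_{v ∈ C, ‖v‖ ≤ 1} |⟨v, g⟩|`, whose second moment is the Gaussian
complexity of `C`. -/
noncomputable def gaussianSup (C : Set (EuclideanSpace ℝ ι)) (g : EuclideanSpace ℝ ι) : ℝ :=
  sSup ((fun v => |inner ℝ v g|) '' {v | v ∈ C ∧ ‖v‖ ≤ 1})

theorem gaussianSup_nonneg (C : Set (EuclideanSpace ℝ ι)) (g : EuclideanSpace ℝ ι) :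
    0 ≤ gaussianSup C g := by
  apply Real.sSup_nonneg
  rintro _ ⟨v, _, rfl⟩
  exact abs_nonneg _

theorem abs_inner_le_gaussianSup {v : EuclideanSpace ℝ ι} (hv : v ∈ C) (hv1 : ‖v‖ ≤ 1)
    (g : EuclideanSpace ℝ ι) : |inner ℝ v g| ≤ gaussianSup C g := by
  refine le_csSup ⟨‖g‖, ?_⟩ ⟨v, ⟨hv, hv1⟩, rfl⟩
  rintro _ ⟨v, hv, rfl⟩
  exact (abs_real_inner_le_norm v g).trans (mul_le_of_le_one_left (norm_nonneg g) hv.2)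

theorem gaussianSup_le {g : EuclideanSpace ℝ ι} {a : ℝ} (ha : 0 ≤ a)
    (h : ∀ v ∈ C, ‖v‖ ≤ 1 → |inner ℝ v g| ≤ a) : gaussianSup C g ≤ a := by
  refine Real.sSup_le ?_ ha
  rintro _ ⟨v, hv, rfl⟩
  exact h v hv.1 hv.2

theorem abs_inner_le_norm_mul_gaussianSup (hC : ∀ v ∈ C, ∀ t : ℝ, 0 < t → t • v ∈ C)
    {v : EuclideanSpace ℝ ι} (hv : v ∈ C) (g : EuclideanSpace ℝ ι) :
    |inner ℝ v g| ≤ ‖v‖ * gaussianSup C g := by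
  rcases eq_or_ne v 0 with rfl | h0
  · simp
  have hpos : 0 < ‖v‖ := norm_pos_iff.2 h0
  have h1 := abs_inner_le_gaussianSup (hC v hv ‖v‖⁻¹ (inv_pos.2 hpos))
    (by rw [norm_smul, norm_inv, norm_norm, inv_mul_cancel₀ hpos.ne']) g
  rwa [real_inner_smul_left, abs_mul, abs_of_pos (inv_pos.2 hpos),
    inv_mul_le_iff₀ hpos] at h1

theorem lipschitzWith_gaussianSup (C : Set (EuclideanSpace ℝ ι)) :
    LipschitzWith 1 (gaussianSup C) := by
  refine LipschitzWith.of_le_add fun x y => ?_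
  refine gaussianSup_le (add_nonneg (gaussianSup_nonneg C y) dist_nonneg) fun v hv hv1 => ?_
  have h1 : inner ℝ v x = inner ℝ v y + inner ℝ v (x - y) := by rw [inner_sub_right]; ring
  have h2 : |inner ℝ v (x - y)| ≤ dist x y := by
    rw [dist_eq_norm]
    exact (abs_real_inner_le_norm v _).trans (mul_le_of_le_one_left (norm_nonneg _) hv1)
  rw [h1]
  exact (abs_add_le _ _).trans (add_le_add (abs_inner_le_gaussianSup hv hv1 y) h2)

theorem gaussianSup_sq (C : Set (EuclideanSpace ℝ ι)) (g : EuclideanSpace ℝ ι) :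
    gaussianSup C g ^ 2 = sSup ((fun v => (inner ℝ v g) ^ 2) '' {v | v ∈ C ∧ ‖v‖ ≤ 1}) := by
  have h0 : 0 ≤ sSup ((fun v => (inner ℝ v g) ^ 2) '' {v | v ∈ C ∧ ‖v‖ ≤ 1}) := by
    apply Real.sSup_nonneg
    rintro _ ⟨v, _, rfl⟩
    positivity
  apply le_antisymm
  · rw [← Real.le_sqrt (gaussianSup_nonneg C g) h0]
    refine gaussianSup_le (Real.sqrt_nonneg _) fun v hv hv1 => Real.abs_le_sqrt ?_
    exact le_csSup (bddAbove_gaussianComplexity C g) ⟨v, ⟨hv, hv1⟩, rfl⟩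
  · refine Real.sSup_le ?_ (sq_nonneg _)
    rintro _ ⟨v, hv, rfl⟩
    exact sq_le_sq.2 ((abs_inner_le_gaussianSup hv.1 hv.2 g).trans (le_abs_self _))

theorem integrable_gaussianSup_sq (C : Set (EuclideanSpace ℝ ι)) :
    Integrable (fun g => gaussianSup C g ^ 2) (stdGaussian (EuclideanSpace ℝ ι)) := by
  simp_rw [gaussianSup_sq]
  exact integrable_gaussianComplexity C

theorem gaussianComplexity_eq_integral_gaussianSup_sq (C : Set (EuclideanSpace ℝ ι)) :
    gaussianComplexity C = ∫ g, gaussianSup C g ^ 2 ∂(stdGaussian (EuclideanSpace ℝ ι)) := by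
  simp_rw [gaussianSup_sq]
  rfl

theorem gaussianComplexity_nonneg (C : Set (EuclideanSpace ℝ ι)) : 0 ≤ gaussianComplexity C := by
  rw [gaussianComplexity_eq_integral_gaussianSup_sq]
  exact integral_nonneg fun _ => sq_nonneg _

theorem sq_integral_gaussianSup_le (C : Set (EuclideanSpace ℝ ι)) :
    (∫ g, gaussianSup C g ∂(stdGaussian (EuclideanSpace ℝ ι))) ^ 2 ≤ gaussianComplexity C := by
  rw [gaussianComplexity_eq_integral_gaussianSup_sq]
  exact (convexOn_pow 2).map_integral_le (by fun_prop) isClosed_Ici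
    (Filter.Eventually.of_forall fun g => gaussianSup_nonneg C g)
    (integrable_lipschitz (lipschitzWith_gaussianSup C)) (integrable_gaussianSup_sq C)

theorem gaussianComplexity_le_integral {W : EuclideanSpace ℝ ι → ℝ}
    (hW : Integrable W (stdGaussian (EuclideanSpace ℝ ι))) (h0 : ∀ g, 0 ≤ W g)
    (h : ∀ v ∈ C, ‖v‖ ≤ 1 → ∀ g, (inner ℝ v g) ^ 2 ≤ W g) :
    gaussianComplexity C ≤ ∫ g, W g ∂(stdGaussian (EuclideanSpace ℝ ι)) := by
  refine integral_mono (integrable_gaussianComplexity C) hW fun g => Real.sSup_le ?_ (h0 g)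
  rintro _ ⟨v, hv, rfl⟩
  exact h v hv.1 hv.2 g

theorem gaussianComplexity_mono (h : C ⊆ D) : gaussianComplexity C ≤ gaussianComplexity D := by
  rw [gaussianComplexity_eq_integral_gaussianSup_sq D]
  refine gaussianComplexity_le_integral (integrable_gaussianSup_sq D) (fun g => sq_nonneg _)
    fun v hv hv1 g => ?_
  exact sq_le_sq.2 ((abs_inner_le_gaussianSup (h hv) hv1 g).trans (le_abs_self _))

/-- A finite union costs a constant factor and the logarithm of the number of sets. -/
theorem gaussianComplexity_le_of_subset_iUnion {κ : Type*} [Fintype κ]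
    {S : κ → Set (EuclideanSpace ℝ ι)} {d : ℝ} (hd : 0 ≤ d) (hCS : C ⊆ ⋃ i, S i)
    (hS : ∀ i, gaussianComplexity (S i) ≤ d) :
    gaussianComplexity C ≤ 2 * d + 44 * (1 + Real.log (Fintype.card κ)) := by
  obtain ⟨W, hWi, hW, hW0, hle⟩ :=
    exists_integrable_deviation_majorant fun i => lipschitzWith_gaussianSup (S i)
  calc gaussianComplexity C
      ≤ ∫ g, (2 * d + 2 * W g) ∂(stdGaussian (EuclideanSpace ℝ ι)) := by
        refine gaussianComplexity_le_integral ((integrable_const _).add (hWi.const_mul 2))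
          (fun g => by linarith [hW0 g]) fun v hv hv1 g => ?_
        obtain ⟨i, hi⟩ := Set.mem_iUnion.1 (hCS hv)
        set m := ∫ y, gaussianSup (S i) y ∂(stdGaussian (EuclideanSpace ℝ ι))
        have hm : m ^ 2 ≤ d := (sq_integral_gaussianSup_le (S i)).trans (hS i)
        have h1 : |inner ℝ v g| ≤ m + max (gaussianSup (S i) g - m) 0 := by
          linarith [abs_inner_le_gaussianSup hi hv1 g, le_max_left (gaussianSup (S i) g - m) 0]
        have h2 : (inner ℝ v g) ^ 2 ≤ (m + max (gaussianSup (S i) g - m) 0) ^ 2 := by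
          rw [← sq_abs]
          gcongr
        linarith [hle i g, add_sq_le (a := m) (b := max (gaussianSup (S i) g - m) 0)]
    _ = 2 * d + 2 * ∫ g, W g ∂(stdGaussian (EuclideanSpace ℝ ι)) := by
        rw [integral_add (integrable_const _) (hWi.const_mul 2)]
        simp [integral_const_mul]
    _ ≤ _ := by linarith

/-- The supremum is the squared norm of the projection of `g` to `V`, a sum of `finrank ℝ V`
squared standard Gaussian variables. -/
theorem gaussianComplexity_submodule_le (V : Submodule ℝ (EuclideanSpace ℝ ι)) :
    gaussianComplexity (V : Set (EuclideanSpace ℝ ι)) ≤ Module.finrank ℝ V := by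
  let e := stdOrthonormalBasis ℝ V
  let L : Fin (Module.finrank ℝ V) → StrongDual ℝ (EuclideanSpace ℝ ι) := fun i =>
    innerSL ℝ (e i : EuclideanSpace ℝ ι)
  have hLi : ∀ i, Integrable (fun g => L i g ^ 2) (stdGaussian (EuclideanSpace ℝ ι)) := fun i =>
    (IsGaussian.memLp_dual _ (L i) 2 (by simp)).integrable_sq
  have hL : ∀ i, ∫ g, L i g ^ 2 ∂(stdGaussian (EuclideanSpace ℝ ι)) = 1 := fun i => by
    rw [← variance_of_integral_eq_zero (L i).continuous.aemeasurable (by simp),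
      variance_dual_stdGaussian]
    simp only [L, innerSL_apply_norm]
    have : ‖e i‖ = 1 := e.orthonormal.1 i
    rw [← Submodule.coe_norm, this, one_pow]
  calc gaussianComplexity (V : Set (EuclideanSpace ℝ ι))
      ≤ ∫ g, ∑ i, L i g ^ 2 ∂(stdGaussian (EuclideanSpace ℝ ι)) := by
        refine gaussianComplexity_le_integral (integrable_finsetSum _ fun i _ => hLi i)
          (fun g => Finset.sum_nonneg fun i _ => sq_nonneg _) fun v hv hv1 g => ?_
        have h1 : ∀ w : V, inner ℝ (w : EuclideanSpace ℝ ι) g =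
            inner ℝ w (V.orthogonalProjectionOnto g) := fun w =>
          (Submodule.inner_orthogonalProjectionOnto_eq_of_mem_left w g).symm
        have h2 : ∑ i, L i g ^ 2 = ‖V.orthogonalProjectionOnto g‖ ^ 2 := by
          rw [← e.sum_sq_inner_right]
          simp only [L, innerSL_apply_apply, h1]
        rw [h2, h1 ⟨v, hv⟩]
        have h3 : |inner ℝ (⟨v, hv⟩ : V) (V.orthogonalProjectionOnto g)| ≤
            ‖V.orthogonalProjectionOnto g‖ :=
          (abs_real_inner_le_norm _ _).trans (mul_le_of_le_one_left (norm_nonneg _) hv1)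
        rw [← sq_abs]
        gcongr
    _ = _ := by
        rw [integral_finsetSum _ fun i _ => hLi i]
        simp [hL]

end GaussianSup

/-! ### Sums of the largest members -/

section Sumtop

variable {ι : Type*} [Fintype ι] {k : ℕ} {a a' : ι → ℝ}

theorem sum_le_sumtop {T : Finset ι} (hT : T.card = min k (Fintype.card ι)) :
    ∑ j ∈ T, a j ≤ sumtop k a :=
  Finset.le_sup' (fun T => ∑ j ∈ T, a j)
    (Finset.mem_powersetCard.2 ⟨Finset.subset_univ T, hT⟩)

theorem sumtop_le {B : ℝ}
    (h : ∀ T : Finset ι, T.card = min k (Fintype.card ι) → ∑ j ∈ T, a j ≤ B) :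
    sumtop k a ≤ B :=
  Finset.sup'_le _ _ fun T hT => h T (Finset.mem_powersetCard.1 hT).2

theorem exists_superset_card_eq_min {T₀ : Finset ι} (h : T₀.card ≤ k) :
    ∃ T, T₀ ⊆ T ∧ T.card = min k (Fintype.card ι) := by
  obtain ⟨T, h1, -, h2⟩ := Finset.exists_subsuperset_card_eq (Finset.subset_univ T₀)
    (le_min h (Finset.card_le_univ T₀)) (min_le_right k (Fintype.card ι))
  exact ⟨T, h1, h2⟩

theorem sumtop_nonneg (ha : ∀ j, 0 ≤ a j) : 0 ≤ sumtop k a := by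
  obtain ⟨T, -, hT⟩ := exists_superset_card_eq_min (T₀ := (∅ : Finset ι)) (Nat.zero_le k)
  exact (Finset.sum_nonneg fun j _ => ha j).trans (sum_le_sumtop hT)

theorem sumtop_le_mul_sumtop {c : ℝ} (hc : 0 ≤ c) (h : ∀ j, a j ≤ c * a' j) :
    sumtop k a ≤ c * sumtop k a' := by
  refine sumtop_le fun T hT => (Finset.sum_le_sum fun j _ => h j).trans ?_
  rw [← Finset.mul_sum]
  exact mul_le_mul_of_nonneg_left (sum_le_sumtop hT) hc

theorem min_mul_le_sumtop {c : ℝ} (h : ∀ j, c ≤ a j) :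
    (min k (Fintype.card ι) : ℕ) * c ≤ sumtop k a := by
  obtain ⟨T, -, hT⟩ := exists_superset_card_eq_min (T₀ := (∅ : Finset ι)) (Nat.zero_le k)
  refine le_trans ?_ (sum_le_sumtop hT)
  rw [← hT, ← nsmul_eq_mul]
  exact Finset.card_nsmul_le_sum _ _ _ fun j _ => h j

theorem sumtop_min_card (a : ι → ℝ) : sumtop (min k (Fintype.card ι)) a = sumtop k a := by
  simp only [sumtop, min_assoc, min_self]

end Sumtop

/-! ### Block structure and Gaussian marginals -/

section Blocks

variable {p : ℕ} {b : Fin p → ℕ}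

theorem inner_eq_sum_inner_block (v g : BinSpace b) :
    inner ℝ v g = ∑ j, inner ℝ (block v j) (block g j) := by
  simp [PiLp.inner_apply, block, Fintype.sum_sigma]

theorem norm_sq_eq_sum_norm_sq_block (v : BinSpace b) : ‖v‖ ^ 2 = ∑ j, ‖block v j‖ ^ 2 := by
  simp_rw [← real_inner_self_eq_norm_sq]
  exact inner_eq_sum_inner_block v v

/-- The `j`-th block as a continuous linear map. -/
noncomputable def blockCLM (b : Fin p → ℕ) (j : Fin p) :
    BinSpace b →L[ℝ] EuclideanSpace ℝ (Fin (b j)) :=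
  LinearMap.toContinuousLinearMap
    { toFun := fun v => block v j
      map_add' := fun _ _ => rfl
      map_smul' := fun _ _ => rfl }

theorem blockCLM_apply (j : Fin p) (v : BinSpace b) : blockCLM b j v = block v j := rfl

/-- The vector whose `j`-th block is `t` and whose other blocks vanish. -/
noncomputable def blockSingle (j : Fin p) (t : EuclideanSpace ℝ (Fin (b j))) : BinSpace b :=
  WithLp.toLp 2 (fun x => if h : x.1 = j then t (h ▸ x.2) else 0)

theorem block_blockSingle_same (j : Fin p) (t : EuclideanSpace ℝ (Fin (b j))) :
    block (blockSingle j t) j = t := by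
  ext k
  simp [block, blockSingle]

theorem block_blockSingle_of_ne {i j : Fin p} (h : i ≠ j) (t : EuclideanSpace ℝ (Fin (b j))) :
    block (blockSingle j t) i = 0 := by
  ext k
  simp [block, blockSingle, h]

theorem inner_blockSingle (j : Fin p) (v : BinSpace b) (t : EuclideanSpace ℝ (Fin (b j))) :
    inner ℝ v (blockSingle j t) = inner ℝ (block v j) t := by
  rw [inner_eq_sum_inner_block, Finset.sum_eq_single j _ (by simp), block_blockSingle_same]
  intro i _ hi
  rw [block_blockSingle_of_ne hi, inner_zero_right]

/-- The blocks of a standard Gaussian vector are standard Gaussian. -/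
theorem stdGaussian_map_blockCLM (j : Fin p) :
    (stdGaussian (BinSpace b)).map (blockCLM b j) =
      stdGaussian (EuclideanSpace ℝ (Fin (b j))) := by
  refine Measure.ext_of_charFun ?_
  ext t
  have h1 : charFun ((stdGaussian (BinSpace b)).map (blockCLM b j)) t =
      charFun (stdGaussian (BinSpace b)) (blockSingle j t) := by
    rw [charFun_apply, charFun_apply, integral_map (by fun_prop)
      (Measurable.aestronglyMeasurable (by fun_prop))]
    simp_rw [inner_blockSingle, blockCLM_apply]
  have h2 : ‖blockSingle j t‖ = ‖t‖ := by
    rw [← sq_eq_sq₀ (norm_nonneg _) (norm_nonneg _), ← real_inner_self_eq_norm_sq,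
      inner_blockSingle, block_blockSingle_same, real_inner_self_eq_norm_sq]
  rw [h1, charFun_stdGaussian, charFun_stdGaussian, h2]

theorem integral_comp_block {j : Fin p} {f : EuclideanSpace ℝ (Fin (b j)) → ℝ}
    (hf : Continuous f) :
    ∫ g, f (block g j) ∂(stdGaussian (BinSpace b)) =
      ∫ x, f x ∂(stdGaussian (EuclideanSpace ℝ (Fin (b j)))) := by
  rw [← stdGaussian_map_blockCLM j, integral_map (by fun_prop) hf.aestronglyMeasurable]
  rfl

theorem norm_block_le (v : BinSpace b) (j : Fin p) : ‖block v j‖ ≤ ‖v‖ := by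
  refine le_of_sq_le_sq ?_ (norm_nonneg v)
  rw [norm_sq_eq_sum_norm_sq_block v]
  exact Finset.single_le_sum (f := fun j => ‖block v j‖ ^ 2) (fun i _ => sq_nonneg _)
    (Finset.mem_univ j)

theorem lipschitzWith_gaussianSup_block (j : Fin p) (S : Set (EuclideanSpace ℝ (Fin (b j)))) :
    LipschitzWith 1 (fun g : BinSpace b => gaussianSup S (block g j)) := by
  refine LipschitzWith.of_dist_le_mul fun x y => ?_
  refine ((lipschitzWith_gaussianSup S).dist_le_mul _ _).trans ?_
  rw [dist_eq_norm, dist_eq_norm]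
  gcongr
  exact norm_block_le (x - y) j

end Blocks

/-! ### Group-sparse vectors -/

section GroupSparse

variable {p : ℕ} {b : Fin p → ℕ} {S : (j : Fin p) → Set (EuclideanSpace ℝ (Fin (b j)))}
  {sG : ℕ}

theorem integrable_gaussianSup_block_sq (j : Fin p) (S : Set (EuclideanSpace ℝ (Fin (b j)))) :
    Integrable (fun g : BinSpace b => gaussianSup S (block g j) ^ 2)
      (stdGaussian (BinSpace b)) := by
  have h := integrable_gaussianSup_sq S
  rw [← stdGaussian_map_blockCLM j] at h
  exact h.comp_measurable (blockCLM b j).measurable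

theorem integral_gaussianSup_block_sq (j : Fin p) (S : Set (EuclideanSpace ℝ (Fin (b j)))) :
    ∫ g, gaussianSup S (block g j) ^ 2 ∂(stdGaussian (BinSpace b)) = gaussianComplexity S := by
  rw [gaussianComplexity_eq_integral_gaussianSup_sq]
  exact integral_comp_block ((lipschitzWith_gaussianSup S).continuous.pow 2)

/-- For fixed `g`, Cauchy–Schwarz over the active blocks reduces the supremum over group-sparse
vectors to the block-wise suprema. -/
theorem exists_inner_sq_le_sum_gaussianSup_sq
    (hS : ∀ j, ∀ v ∈ S j, ∀ t : ℝ, 0 < t → t • v ∈ S j) {v : BinSpace b}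
    (hv : v ∈ groupSparseSet sG S) (hv1 : ‖v‖ ≤ 1) :
    ∃ T : Finset (Fin p), T.card = min sG (Fintype.card (Fin p)) ∧
      ∀ g : BinSpace b, (inner ℝ v g) ^ 2 ≤ ∑ j ∈ T, gaussianSup (S j) (block g j) ^ 2 := by
  classical
  obtain ⟨T, hsub, hT⟩ := exists_superset_card_eq_min
    (T₀ := Finset.univ.filter fun j => block v j ≠ 0) (k := sG) (by
      refine le_trans (le_of_eq ?_) hv.1
      unfold groupSparsity
      congr)
  refine ⟨T, hT, fun g => ?_⟩
  have h1 : inner ℝ v g = ∑ j ∈ T, inner ℝ (block v j) (block g j) := by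
    rw [inner_eq_sum_inner_block]
    refine (Finset.sum_subset (Finset.subset_univ T) fun j _ hj => ?_).symm
    have : block v j = 0 := by
      by_contra h
      exact hj (hsub (by simpa using h))
    rw [this, inner_zero_left]
  have h2 : |inner ℝ v g| ≤ ∑ j ∈ T, ‖block v j‖ * gaussianSup (S j) (block g j) := by
    rw [h1]
    refine (Finset.abs_sum_le_sum_abs _ _).trans (Finset.sum_le_sum fun j _ => ?_)
    exact abs_inner_le_norm_mul_gaussianSup (hS j) (hv.2 j) _
  have h3 : ∑ j ∈ T, ‖block v j‖ ^ 2 ≤ 1 := by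
    refine (Finset.sum_le_univ_sum_of_nonneg fun j => sq_nonneg _).trans ?_
    rw [← norm_sq_eq_sum_norm_sq_block]
    exact pow_le_one₀ (norm_nonneg v) hv1
  calc (inner ℝ v g) ^ 2 = |inner ℝ v g| ^ 2 := (sq_abs _).symm
    _ ≤ (∑ j ∈ T, ‖block v j‖ * gaussianSup (S j) (block g j)) ^ 2 := by gcongr
    _ ≤ (∑ j ∈ T, ‖block v j‖ ^ 2) * ∑ j ∈ T, gaussianSup (S j) (block g j) ^ 2 :=
      Finset.sum_mul_sq_le_sq_mul_sq _ _ _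
    _ ≤ 1 * ∑ j ∈ T, gaussianSup (S j) (block g j) ^ 2 := by
      gcongr
    _ = _ := one_mul _

/-- If `m` has Euclidean norm at most `A` over `T` and no `x j` exceeds `m j` by more than `√w`,
then Minkowski's inequality bounds `∑ x j ^ 2` by `(A + √(|T| w)) ^ 2`. Here the cross term
`2 A √(|T| w)` is replaced by a bound affine in `w`, at an arbitrary scale `r`, so that the result
can be integrated when `w` is random. -/
theorem sum_sq_le_of_deviation_le {κ : Type*} {T : Finset κ} {x m : κ → ℝ} {A w r : ℝ}
    (hx : ∀ j, 0 ≤ x j) (hA : 0 ≤ A) (hr : 0 < r)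
    (hmA : ∑ j ∈ T, m j ^ 2 ≤ A ^ 2) (hw : ∀ j, max (x j - m j) 0 ^ 2 ≤ w) :
    ∑ j ∈ T, x j ^ 2 ≤ A ^ 2 + A * (T.card * w / r + r) + T.card * w := by
  let d : κ → ℝ := fun j => max (x j - m j) 0
  have hd0 : ∀ j, 0 ≤ d j := fun j => le_max_right _ _
  have hd : ∑ j ∈ T, d j ^ 2 ≤ T.card * w := by
    rw [← nsmul_eq_mul]
    exact Finset.sum_le_card_nsmul _ _ _ fun j _ => hw j
  have hq0 : 0 ≤ T.card * w := (Finset.sum_nonneg fun j _ => sq_nonneg (d j)).trans hd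
  set q := T.card * w with hq
  have h1 : ∑ j ∈ T, x j ^ 2 ≤ ∑ j ∈ T, (m j + d j) ^ 2 := by
    gcongr with j
    · exact hx j
    · linarith [le_max_left (x j - m j) 0]
  have hcs : ∑ j ∈ T, m j * d j ≤ A * Real.sqrt q := by
    refine (le_abs_self _).trans (abs_le_of_sq_le_sq ?_ (by positivity))
    rw [mul_pow, Real.sq_sqrt hq0]
    refine (Finset.sum_mul_sq_le_sq_mul_sq T m d).trans ?_
    gcongr
  have ham : 2 * Real.sqrt q ≤ q / r + r := by
    rw [← sub_nonneg]
    have h2 : q / r + r - 2 * Real.sqrt q = (Real.sqrt q - r) ^ 2 / r := by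
      nth_rewrite 1 [← Real.sq_sqrt hq0]
      field_simp
      ring
    rw [h2]
    positivity
  have h3 : ∑ j ∈ T, (m j + d j) ^ 2 =
      ∑ j ∈ T, m j ^ 2 + 2 * ∑ j ∈ T, m j * d j + ∑ j ∈ T, d j ^ 2 := by
    rw [Finset.mul_sum, ← Finset.sum_add_distrib, ← Finset.sum_add_distrib]
    exact Finset.sum_congr rfl fun j _ => by ring
  nlinarith [mul_le_mul_of_nonneg_left ham hA]

/-- The means of the block-wise suprema contribute `sumtop sG` of the complexities, by Jensen's
inequality; their deviations are uniformly of order `√(log p)`. -/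
theorem gaussianComplexity_groupSparseSet_le
    (hS : ∀ j, ∀ v ∈ S j, ∀ t : ℝ, 0 < t → t • v ∈ S j) :
    gaussianComplexity (groupSparseSet sG S) ≤
      (Real.sqrt (sumtop sG (fun j => gaussianComplexity (S j))) +
        9 * Real.sqrt (sG * Real.log p)) ^ 2 := by
  have hω : 0 ≤ sumtop sG (fun j => gaussianComplexity (S j)) :=
    sumtop_nonneg fun j => gaussianComplexity_nonneg _
  set A := Real.sqrt (sumtop sG (fun j => gaussianComplexity (S j))) with hA
  have hA0 : 0 ≤ A := Real.sqrt_nonneg _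
  have hA2 : A ^ 2 = sumtop sG (fun j => gaussianComplexity (S j)) := Real.sq_sqrt hω
  rcases le_or_gt p sG with hp | hp
  · -- every block may be active, and no union over supports is needed
    have hcard : (Finset.univ : Finset (Fin p)).card = min sG (Fintype.card (Fin p)) := by
      simp [hp]
    calc gaussianComplexity (groupSparseSet sG S)
        ≤ ∫ g, ∑ j, gaussianSup (S j) (block g j) ^ 2 ∂(stdGaussian (BinSpace b)) := by
          refine gaussianComplexity_le_integral
            (integrable_finsetSum _ fun j _ => integrable_gaussianSup_block_sq j _)
            (fun g => Finset.sum_nonneg fun j _ => sq_nonneg _) fun v hv hv1 g => ?_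
          obtain ⟨T, -, h⟩ := exists_inner_sq_le_sum_gaussianSup_sq hS hv hv1
          exact (h g).trans (Finset.sum_le_univ_sum_of_nonneg fun j => sq_nonneg _)
      _ = ∑ j, gaussianComplexity (S j) := by
          rw [integral_finsetSum _ fun j _ => integrable_gaussianSup_block_sq j _]
          simp_rw [integral_gaussianSup_block_sq]
      _ ≤ A ^ 2 := by
          rw [hA2]
          exact sum_le_sumtop hcard
      _ ≤ _ := by
          gcongr
          exact le_add_of_nonneg_right (by positivity)
  rcases Nat.eq_zero_or_pos sG with rfl | hsG
  · -- no block is active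
    refine le_trans ?_ (sq_nonneg _)
    refine (gaussianComplexity_le_integral (W := 0) (integrable_zero _ _ _) (fun _ => le_rfl)
      fun v hv hv1 g => ?_).trans (by simp)
    obtain ⟨T, hT, h⟩ := exists_inner_sq_le_sum_gaussianSup_sq hS hv hv1
    have : T = ∅ := by simpa using hT
    simpa [this] using h g
  have hlog : Real.log 2 ≤ Real.log p :=
    Real.log_le_log (by norm_num) (by exact_mod_cast (by omega : 2 ≤ p))
  have hlog2 := Real.log_two_gt_d9
  have hsG1 : (0 : ℝ) < sG := by exact_mod_cast hsG
  set r := 9 * Real.sqrt (sG * Real.log p) with hr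
  have hpos : 0 < sG * Real.log p := mul_pos hsG1 (by linarith)
  have hr0 : 0 < r := by positivity
  have hr2 : r ^ 2 = 81 * (sG * Real.log p) := by
    rw [hr, mul_pow, Real.sq_sqrt hpos.le]
    norm_num
  obtain ⟨W, hWi, hW, hW0, hle⟩ := exists_integrable_deviation_majorant
    fun j => lipschitzWith_gaussianSup_block j (S j)
  rw [Fintype.card_fin] at hW
  have hWr : sG * ∫ g, W g ∂(stdGaussian (BinSpace b)) ≤ r ^ 2 := by
    rw [hr2]
    calc sG * ∫ g, W g ∂(stdGaussian (BinSpace b)) ≤ sG * (22 * (1 + Real.log p)) := by gcongr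
      _ ≤ sG * (81 * Real.log p) := by
        refine mul_le_mul_of_nonneg_left ?_ hsG1.le
        linarith
      _ = _ := by ring
  calc gaussianComplexity (groupSparseSet sG S)
      ≤ ∫ g, (A ^ 2 + A * r + (A / r + 1) * sG * W g) ∂(stdGaussian (BinSpace b)) := by
        refine gaussianComplexity_le_integral ((integrable_const _).add (hWi.const_mul _))
          (fun g => by have := hW0 g; positivity) fun v hv hv1 g => ?_
        obtain ⟨T, hT, h⟩ := exists_inner_sq_le_sum_gaussianSup_sq hS hv hv1
        have hTc : T.card = sG := by
          rw [hT, Fintype.card_fin]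
          omega
        refine (h g).trans ((sum_sq_le_of_deviation_le (A := A) (r := r)
          (fun j => gaussianSup_nonneg (S j) _)
          hA0 hr0 ?_ fun j => hle j g).trans (le_of_eq ?_))
        · rw [hA2]
          refine le_trans (Finset.sum_le_sum fun j _ => ?_) (sum_le_sumtop hT)
          rw [integral_comp_block (lipschitzWith_gaussianSup (S j)).continuous]
          exact sq_integral_gaussianSup_le (S j)
        · rw [hTc]
          ring
    _ = A ^ 2 + A * r + (A / r + 1) * (sG * ∫ g, W g ∂(stdGaussian (BinSpace b))) := by
        rw [integral_add (integrable_const _) (hWi.const_mul _), integral_const_mul]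
        simp [mul_assoc]
    _ ≤ A ^ 2 + A * r + (A / r + 1) * r ^ 2 := by gcongr
    _ = (A + r) ^ 2 := by
        field_simp

end GroupSparse

/-! ### Covering piecewise-linear vectors by subspaces -/

section PiecewiseLinear

variable {d s : ℕ}

/-- A vector with at most `s` jumps is piecewise linear, with zero slopes: the segment of `i` is the
number of jumps before `i`. -/
theorem exists_monotone_of_pcSmoothness_le {a : EuclideanSpace ℝ (Fin d)}
    (h : pcSmoothness a ≤ s) :
    ∃ (σ : Fin d → Fin (s + 1)) (β : Fin (s + 1) → ℝ), Monotone σ ∧ ∀ i, a i = β (σ i) := by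
  classical
  let J : Finset (Fin d) :=
    Finset.univ.filter fun i : Fin d => ∃ h : (i : ℕ) + 1 < d, a i ≠ a ⟨(i : ℕ) + 1, h⟩
  have hJ : J.card ≤ s := by
    refine le_trans (le_of_eq ?_) h
    unfold pcSmoothness
    congr
  let N : Fin d → ℕ := fun i => (J.filter fun k => k < i).card
  have hN : ∀ i, N i < s + 1 := fun i =>
    Nat.lt_succ_of_le ((Finset.card_filter_le _ _).trans hJ)
  have hmono : Monotone N := fun i j hij =>
    Finset.card_le_card (Finset.monotone_filter_right _ fun k _ hk => lt_of_lt_of_le hk hij)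
  -- equal counts leave no room for a jump in between
  have key : ∀ n i (hi : i + n < d), N ⟨i, by omega⟩ = N ⟨i + n, hi⟩ →
      a ⟨i, by omega⟩ = a ⟨i + n, hi⟩ := by
    intro n
    induction n with
    | zero => intro i hi _; rfl
    | succ n ih =>
      intro i hi hc
      have h1 : N ⟨i, by omega⟩ ≤ N ⟨i + n, by omega⟩ := hmono (by simp)
      have h2 : N ⟨i + n, by omega⟩ ≤ N ⟨i + (n + 1), hi⟩ := hmono (by simp)
      rw [ih i (by omega) (by omega)]
      by_contra hne
      have hmem : (⟨i + n, by omega⟩ : Fin d) ∈ J := by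
        simp only [J, Finset.mem_filter, Finset.mem_univ, true_and]
        exact ⟨by omega, hne⟩
      have h3 : N ⟨i + n, by omega⟩ < N ⟨i + (n + 1), hi⟩ := by
        refine Finset.card_lt_card (Finset.ssubset_iff_of_subset
          (Finset.monotone_filter_right _ fun k _ hk => hk.trans_le (by simp)) |>.2
          ⟨⟨i + n, by omega⟩, ?_, ?_⟩)
        · simp only [Finset.mem_filter, hmem, true_and, Fin.mk_lt_mk]
          omega
        · simp
      omega
  have key' : ∀ i j, i ≤ j → N i = N j → a i = a j := by
    rintro ⟨i, hi⟩ ⟨j, hj⟩ hij hc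
    obtain ⟨n, rfl⟩ := Nat.exists_eq_add_of_le (Fin.mk_le_mk.1 hij)
    exact key n i hj hc
  refine ⟨fun i => ⟨N i, hN i⟩,
    fun t => if ht : ∃ i, N i = t then a ht.choose else 0, fun i j hij => hmono hij, fun i => ?_⟩
  have hex : ∃ k, N k = N i := ⟨i, rfl⟩
  simp only [dif_pos hex]
  rcases le_total i hex.choose with hle | hle
  · exact key' _ _ hle hex.choose_spec.symm
  · exact (key' _ _ hle hex.choose_spec).symm

theorem LocalModel.Holds.isPiecewiseLinear {m : LocalModel} {a : EuclideanSpace ℝ (Fin d)}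
    (h : m.Holds s a) : IsPiecewiseLinear s a := by
  cases m with
  | piecewiseLinear => exact h
  | piecewiseConstant =>
    obtain ⟨σ, β, hσ, ha⟩ := exists_monotone_of_pcSmoothness_le h
    exact ⟨σ, 0, β, hσ, fun i => by simp [ha i]⟩

/-- The vector that is affine on each level set of `σ`, with the given slopes and intercepts. -/
noncomputable def affineOnLevelsMap (σ : Fin d → Fin (s + 1)) :
    (Fin (s + 1) → ℝ) × (Fin (s + 1) → ℝ) →ₗ[ℝ] EuclideanSpace ℝ (Fin d) where
  toFun q := WithLp.toLp 2 fun i => q.1 (σ i) * (i : ℝ) + q.2 (σ i)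
  map_add' x y := by
    ext i
    simp
    ring
  map_smul' c x := by
    ext i
    simp
    ring

theorem mem_range_affineOnLevelsMap {σ : Fin d → Fin (s + 1)} {a : EuclideanSpace ℝ (Fin d)}
    {α β : Fin (s + 1) → ℝ} (h : ∀ i : Fin d, a i = α (σ i) * (i : ℝ) + β (σ i)) :
    a ∈ LinearMap.range (affineOnLevelsMap σ) :=
  ⟨(α, β), by ext i; simp [affineOnLevelsMap, h i]⟩

theorem finrank_range_affineOnLevelsMap_le (σ : Fin d → Fin (s + 1)) :
    Module.finrank ℝ (LinearMap.range (affineOnLevelsMap σ)) ≤ 2 * (s + 1) := by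
  refine (LinearMap.finrank_range_le _).trans ?_
  rw [Module.finrank_prod, Module.finrank_fin_fun]
  omega

/-- The segmentation of the indices with thresholds `f`: the segment of `i` is the number of
thresholds at most `i`. -/
def thresholdSegment (f : Fin s → Fin (d + 1)) (i : Fin d) : Fin (s + 1) :=
  ⟨(Finset.univ.filter fun t => (f t : ℕ) ≤ i).card,
    Nat.lt_succ_of_le ((Finset.card_filter_le _ _).trans (by simp))⟩

/-- A segmentation is determined by the end positions of its first `s` segments. -/
theorem exists_thresholdSegment_eq {σ : Fin d → Fin (s + 1)} (hσ : Monotone σ) :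
    ∃ f : Fin s → Fin (d + 1), thresholdSegment f = σ := by
  let B : Fin s → Finset (Fin d) := fun t => Finset.univ.filter fun i => (σ i : ℕ) ≤ t
  refine ⟨fun t => ⟨(B t).card, Nat.lt_succ_of_le ((Finset.card_le_univ _).trans (by simp))⟩, ?_⟩
  have key : ∀ t (i : Fin d), (B t).card ≤ (i : ℕ) ↔ (t : ℕ) < σ i := by
    intro t i
    constructor
    · intro h
      by_contra hlt
      have hsub : Finset.Iic i ⊆ B t := fun k hk => by
        have h1 : (σ k : ℕ) ≤ σ i := hσ (Finset.mem_Iic.1 hk)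
        simp only [B, Finset.mem_filter, Finset.mem_univ, true_and]
        omega
      have := Finset.card_le_card hsub
      rw [Fin.card_Iic] at this
      omega
    · intro h
      have hsub : B t ⊆ Finset.Iio i := fun k hk => by
        simp only [B, Finset.mem_filter, Finset.mem_univ, true_and] at hk
        rw [Finset.mem_Iio]
        by_contra hlt
        have h1 : (σ i : ℕ) ≤ σ k := hσ (not_lt.1 hlt)
        omega
      have := Finset.card_le_card hsub
      rwa [Fin.card_Iio] at this
  ext i
  simp only [thresholdSegment, key]
  rw [Fin.card_filter_val_lt, min_eq_right (Nat.lt_succ_iff.1 (σ i).isLt)]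

/-- The set is covered by `(b + 1) ^ s` subspaces of dimension at most `2 * (s + 1)`. -/
theorem gaussianComplexity_isPiecewiseLinear_le (b s : ℕ) :
    gaussianComplexity {a : EuclideanSpace ℝ (Fin b) | IsPiecewiseLinear s a} ≤
      48 + 4 * s + 44 * (s * Real.log (b + 1)) := by
  have h := gaussianComplexity_le_of_subset_iUnion
    (C := {a : EuclideanSpace ℝ (Fin b) | IsPiecewiseLinear s a})
    (S := fun f : Fin s → Fin (b + 1) =>
      (LinearMap.range (affineOnLevelsMap (thresholdSegment f)) : Set (EuclideanSpace ℝ (Fin b))))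
    (d := 2 * (s + 1)) (by positivity) (fun a ha => ?_) (fun f => ?_)
  · refine h.trans (le_of_eq ?_)
    simp only [Fintype.card_fun, Fintype.card_fin]
    push_cast
    rw [Real.log_pow]
    ring
  · obtain ⟨σ, α, β, hσ, ha⟩ := ha
    obtain ⟨f, rfl⟩ := exists_thresholdSegment_eq hσ
    exact Set.mem_iUnion.2 ⟨f, mem_range_affineOnLevelsMap ha⟩
  · refine (gaussianComplexity_submodule_le _).trans ?_
    exact_mod_cast finrank_range_affineOnLevelsMap_le (thresholdSegment f)

theorem gaussianComplexity_holds_le {b s : ℕ} (m : LocalModel) (hb : 2 ≤ b) (hs : 1 ≤ s) :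
    gaussianComplexity {a : EuclideanSpace ℝ (Fin b) | m.Holds s a} ≤
      192 * ((s : ℝ) * Real.log b) := by
  have hb' : (2 : ℝ) ≤ b := by exact_mod_cast hb
  have hs' : (1 : ℝ) ≤ s := by exact_mod_cast hs
  have h1 : 1 ≤ 2 * Real.log b := by
    linarith [Real.log_two_gt_d9, Real.log_le_log (by norm_num) hb']
  have h2 : Real.log (b + 1) ≤ 2 * Real.log b := by
    rw [← Real.log_rpow (by linarith)]
    refine Real.log_le_log (by linarith) ?_
    norm_num
    nlinarith
  have h3 : (s : ℝ) ≤ 2 * (s * Real.log b) := by nlinarith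
  have h4 : s * Real.log (b + 1) ≤ 2 * (s * Real.log b) := by nlinarith
  have h5 := (gaussianComplexity_mono
    (fun a ha => LocalModel.Holds.isPiecewiseLinear ha :
      {a : EuclideanSpace ℝ (Fin b) | m.Holds s a} ⊆ {a | IsPiecewiseLinear s a})).trans
    (gaussianComplexity_isPiecewiseLinear_le b s)
  linarith

end PiecewiseLinear

/-! ### Centered blocks and the constraint set -/

section ConstraintSet

theorem pcSmoothness_smul {d : ℕ} (a : EuclideanSpace ℝ (Fin d)) {t : ℝ} (ht : t ≠ 0) :
    pcSmoothness (t • a) = pcSmoothness a := by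
  simp [pcSmoothness, ht]

theorem LocalModel.Holds.smul {m : LocalModel} {d s : ℕ} {a : EuclideanSpace ℝ (Fin d)}
    (h : m.Holds s a) {t : ℝ} (ht : 0 < t) : m.Holds s (t • a) := by
  cases m with
  | piecewiseConstant => exact (pcSmoothness_smul a ht.ne').trans_le h
  | piecewiseLinear =>
    obtain ⟨σ, α, β, hσ, ha⟩ := h
    refine ⟨σ, t • α, t • β, hσ, fun i => ?_⟩
    simp [ha i]
    ring

theorem gaussianComplexity_subset_zero {ι : Type*} [Fintype ι] {C : Set (EuclideanSpace ℝ ι)}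
    (h : ∀ v ∈ C, v = 0) : gaussianComplexity C ≤ 0 := by
  refine (gaussianComplexity_le_integral (W := 0) (integrable_zero _ _ _) (fun _ => le_rfl)
    fun v hv _ g => ?_).trans (by simp)
  simp [h v hv]

theorem eq_zero_of_pcSmoothness_eq_zero {d : ℕ} {a : EuclideanSpace ℝ (Fin d)}
    (h : pcSmoothness a ≤ 0) (hsum : ∑ k, a k = 0) : a = 0 := by
  obtain ⟨σ, β, -, ha⟩ := exists_monotone_of_pcSmoothness_le h
  have hc : ∀ i, a i = β 0 := fun i => by rw [ha i, Fin.fin_one_eq_zero (σ i)]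
  ext i
  have hd : (d : ℝ) ≠ 0 := by
    have := i.pos
    positivity
  simp only [hc, Finset.sum_const, Finset.card_univ, Fintype.card_fin, nsmul_eq_mul,
    mul_eq_zero, hd, false_or] at hsum
  simp [hc i, hsum]

/-- The bound for a single block. A block with no breaks is zero in the piecewise-constant case; in
the piecewise-linear case it ranges over a line, and `log p` has to pay for it. -/
theorem gaussianComplexity_centered_le {p b s : ℕ} (m : LocalModel) (hp : 1 ≤ p)
    (h : p = 1 → m = LocalModel.piecewiseLinear → 1 ≤ s) :
    gaussianComplexity {a : EuclideanSpace ℝ (Fin b) | m.Holds s a ∧ ∑ k, a k = 0} ≤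
      192 * ((s : ℝ) * Real.log b + Real.log p) := by
  have hlogp : 0 ≤ Real.log p := Real.log_natCast_nonneg p
  have hlogb : 0 ≤ Real.log b := Real.log_natCast_nonneg b
  have hnn : 0 ≤ 192 * ((s : ℝ) * Real.log b + Real.log p) := by positivity
  rcases lt_or_ge b 2 with hb | hb
  · refine (gaussianComplexity_subset_zero fun a ha => ?_).trans hnn
    have := ha.2
    interval_cases b
    · exact Subsingleton.elim _ _
    · ext i
      rw [Subsingleton.elim i 0]
      simpa using this
  rcases Nat.eq_zero_or_pos s with rfl | hs
  · cases m with
    | piecewiseConstant =>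
      exact (gaussianComplexity_subset_zero fun a ha =>
        eq_zero_of_pcSmoothness_eq_zero ha.1 ha.2).trans hnn
    | piecewiseLinear =>
      have hp2 : 2 ≤ p := by
        by_contra hlt
        have := h (by omega) rfl
        omega
      have h1 : Real.log 2 ≤ Real.log p :=
        Real.log_le_log (by norm_num) (by exact_mod_cast hp2)
      have h2 := (gaussianComplexity_mono (fun a ha => ha.1 :
        {a : EuclideanSpace ℝ (Fin b) | LocalModel.piecewiseLinear.Holds 0 a ∧ ∑ k, a k = 0} ⊆
          {a | IsPiecewiseLinear 0 a})).trans (gaussianComplexity_isPiecewiseLinear_le b 0)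
      have h3 := Real.log_two_gt_d9
      simp only [Nat.cast_zero, zero_mul, mul_zero, add_zero, zero_add] at h2 ⊢
      linarith
  · have h1 := (gaussianComplexity_mono (fun a ha => ha.1 :
      {a : EuclideanSpace ℝ (Fin b) | m.Holds s a ∧ ∑ k, a k = 0} ⊆
        {a | m.Holds s a})).trans (gaussianComplexity_holds_le m hb hs)
    linarith

theorem groupSparsity_le {p : ℕ} {b : Fin p → ℕ} (v : BinSpace b) : groupSparsity v ≤ p :=
  (Finset.card_le_univ _).trans (by simp)

theorem gaussianComplexity_constraintSet_le {p : ℕ} (b : Fin p → ℕ) (m : Fin p → LocalModel)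
    (sG : ℕ) (sL : Fin p → ℕ)
    (h : p = 1 → ∀ j, m j = LocalModel.piecewiseLinear → 1 ≤ sL j) :
    gaussianComplexity (constraintSet b m sG sL) ≤
      546 * sumtop sG (fun j => (sL j : ℝ) * Real.log (b j) + Real.log p) := by
  let S : (j : Fin p) → Set (EuclideanSpace ℝ (Fin (b j))) := fun j =>
    {a | (m j).Holds (sL j) a ∧ ∑ k, a k = 0}
  set R := sumtop sG (fun j => (sL j : ℝ) * Real.log (b j) + Real.log p) with hR
  have hlogp : 0 ≤ Real.log p := Real.log_natCast_nonneg p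
  have hS : ∀ j, ∀ v ∈ S j, ∀ t : ℝ, 0 < t → t • v ∈ S j := fun j v hv t ht => by
    refine ⟨hv.1.smul ht, ?_⟩
    simp [← Finset.mul_sum, hv.2]
  -- `sG` may exceed `p`, but then only `p` blocks can be active
  have hsub : constraintSet b m sG sL ⊆ groupSparseSet (min sG p) S := fun v hv =>
    ⟨le_min hv.1 (groupSparsity_le v), hv.2⟩
  have hω : sumtop sG (fun j => gaussianComplexity (S j)) ≤ 192 * R :=
    sumtop_le_mul_sumtop (by norm_num) fun j =>
      gaussianComplexity_centered_le (m j) j.pos fun h1 => h h1 j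
  have hlog : (min sG p : ℕ) * Real.log p ≤ R := by
    have := min_mul_le_sumtop (k := sG) (c := Real.log p)
      (a := fun j : Fin p => (sL j : ℝ) * Real.log (b j) + Real.log p)
      fun j => le_add_of_nonneg_left (mul_nonneg (Nat.cast_nonneg _) (Real.log_natCast_nonneg _))
    rwa [Fintype.card_fin] at this
  have hmin : sumtop (min sG p) (fun j => gaussianComplexity (S j)) =
      sumtop sG (fun j => gaussianComplexity (S j)) := by
    have := sumtop_min_card (k := sG) (fun j => gaussianComplexity (S j))
    rwa [Fintype.card_fin] at this
  have h1 := (gaussianComplexity_mono hsub).trans (gaussianComplexity_groupSparseSet_le hS)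
  rw [hmin] at h1
  refine h1.trans (add_sq_le.trans ?_)
  rw [mul_pow, Real.sq_sqrt (sumtop_nonneg fun j => gaussianComplexity_nonneg _),
    Real.sq_sqrt (by positivity)]
  linarith

end ConstraintSet

theorem mainTheorem4 :
    -- complexity of the constraint set
    (∃ c : ℝ, 0 < c ∧ ∀ (p : ℕ) (b : Fin p → ℕ) (m : Fin p → LocalModel) (sG : ℕ) (sL : Fin p → ℕ),
      (p = 1 → ∀ j, m j = LocalModel.piecewiseLinear → 1 ≤ sL j) →
      gaussianComplexity (constraintSet b m sG sL) ≤
        c * sumtop sG (fun j => (sL j : ℝ) * Real.log (b j) + Real.log p)) ∧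
    -- group-sparse vectors with blocks in given cones
    (∃ c : ℝ, 0 < c ∧ ∀ (p : ℕ) (b : Fin p → ℕ) (sG : ℕ)
      (S : (j : Fin p) → Set (EuclideanSpace ℝ (Fin (b j)))),
      (∀ j, ∀ v ∈ S j, ∀ t : ℝ, 0 < t → t • v ∈ S j) →
      gaussianComplexity (groupSparseSet sG S) ≤
        (Real.sqrt (sumtop sG (fun j => gaussianComplexity (S j))) +
          c * Real.sqrt (sG * Real.log p)) ^ 2) ∧
    -- piecewise-constant and piecewise-linear vectors
    (∃ c : ℝ, 0 < c ∧ ∀ (b s : ℕ) (m : LocalModel), 2 ≤ b → 1 ≤ s →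
      gaussianComplexity {a : EuclideanSpace ℝ (Fin b) | m.Holds s a} ≤
        c * ((s : ℝ) * Real.log b)) :=
  ⟨⟨546, by norm_num, fun _ b m sG sL h => gaussianComplexity_constraintSet_le b m sG sL h⟩,
    ⟨9, by norm_num, fun _ _ _ _ hS => gaussianComplexity_groupSparseSet_le hS⟩,
    ⟨192, by norm_num, fun _ _ m hb hs => gaussianComplexity_holds_le m hb hs⟩⟩
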